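/- Let $\eta(z)=q^{1/24}\prod_{n\ge 1}(1-q^n)$, where $q=e^{2\pi i z}$ and $q^{1/24}=e^{2\pi i z/24}$, be the Dedekind eta function on the upper half plane. Let $N\ge 1$ be an integer, let $r_\delta\in\mathbf{Z}$ for every positive divisor $\delta$ of $N$, and put $g(z)=\prod_{\delta\mid N}\eta(\delta z)^{r_\delta}$. Suppose that $\sum_{\delta\mid N}r_\delta=0$. For a Dirichlet character $\chi$ modulo $N$ and a congruence subgroup $\Gamma\subseteq\Gamma_0(N)$ of $\mathrm{SL}_2(\mathbf{Z})$, a modular function of weight $0$ for $\Gamma$ with character $\chi$ is a function $f$ on the upper half plane that is meromorphic there, satisfies $f\left(\frac{az+b}{cz+d}\right)=\chi(d)f(z)$ for all $\begin{pmatrix}a&b\\c&d\end{pmatrix}\in\Gamma$, and is meromorphic at all cusps (for every $\gamma\in\mathrm{SL}_2(\mathbf{Z})$ there is an integer $h\ge1$ such that, for $\operatorname{Im} z$ large, $f(\gamma z)$ is a function of $e^{2\pi i z/h}$ that is meromorphic at $0$). (1) If $$\sum_{\delta\mid N} r_\delta\,\delta\equiv 0 \pmod{24}\quad\text{and}\quad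 \sum_{\delta\mid N} r_\delta\,\frac N\delta\equiv 0 \pmod{24},$$ then there is a Dirichlet character $\chi$ modulo $N$ with values in $\{0,1,-1\}$ such that $$\chi(d)=\prod_{\delta\mid N}\left(\frac{N/\delta}{d}\right)^{r_\delta}\quad\text{for all integers } d \text{ coprime to } N$$ (Kronecker symbols), and $g$ is a modular function of weight $0$ for $\Gamma_0(N)$ with character $\chi$. (2) If these two congruences are only assumed modulo $8$, then there is still a Dirichlet character $\chi$ modulo $N$ with values in $\{0,1,-1\}$ given by the same formula. In this case $g$ is a modular function of weight $0$ with character $\chi$ for $\Gamma_0(N)\cap\Gamma(6)$ if $3\nmid N$, and for $\Gamma_0(3N)\cap\Gamma(6)$ for every $N$. -/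

import Mathlib

open UpperHalfPlane
open scoped MatrixGroups ModularForm

/-- The Kronecker symbol `(a / n)` for arbitrary integers `a` and `n`. With `n = u * 2 ^ v * m`,
where `u = ±1` and `m` is odd and positive, it is `(a / u) * (a / 2) ^ v * (a / m)`. Here `(a / 1) = 1`,
`(a / -1)` is the sign of `a` (and `1` for `a = 0`), `(a / 2) = χ₈ a` is `0` for even `a`, `1` for
`a ≡ ±1 mod 8` and `-1` for `a ≡ ±3 mod 8`, and `(a / m)` is the Jacobi symbol. Finally,
`(a / 0)` is `1` if `a = ±1` and `0` otherwise. -/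
def kroneckerSymbol (a n : ℤ) : ℤ :=
  if n = 0 then (if a.natAbs = 1 then 1 else 0)
  else (if n < 0 ∧ a < 0 then -1 else 1) *
    ZMod.χ₈ (a : ZMod 8) ^ (n.natAbs.factorization 2) *
    jacobiSym a (n.natAbs / 2 ^ (n.natAbs.factorization 2))

/-- The eta-quotient `z ↦ ∏_{δ ∣ N} η(δ z) ^ r_δ` on the upper half plane. -/
noncomputable def etaQuotient (N : ℕ) (r : ℕ → ℤ) (z : ℍ) : ℂ :=
  ∏ δ ∈ N.divisors, ModularForm.eta ((δ : ℂ) * (z : ℂ)) ^ (r δ)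

/-- The value `∏_{δ ∣ N} ((N/δ) / d) ^ r_δ` at an integer `d` (meant for `d` coprime to `N`, where
every factor is `±1`). -/
noncomputable def etaQuotientSign (N : ℕ) (r : ℕ → ℤ) (d : ℤ) : ℂ :=
  ∏ δ ∈ N.divisors, (kroneckerSymbol ((N / δ : ℕ) : ℤ) d : ℂ) ^ (r δ)

/-- `f` is meromorphic at the cusp `∞`: for some integer `h > 0`, in a half plane `Im z > A`
it is a function of `q = exp (2 π i z / h)` that is meromorphic at `q = 0`. -/
def IsMeromorphicAtInfty (f : ℍ → ℂ) : Prop :=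
  ∃ h : ℕ, 0 < h ∧ ∃ F : ℂ → ℂ, MeromorphicAt F 0 ∧
    ∀ᶠ z : ℍ in atImInfty, f z = F (Function.Periodic.qParam (h : ℝ) (z : ℂ))

/-- `f` is a (meromorphic) modular function of weight `k` for the subgroup `Γ` of `SL(2, ℤ)`
(contained in `Γ₀(N)`) with character `χ` modulo `N`: it is meromorphic on the upper half plane,
satisfies `f ((a z + b) / (c z + d)) = χ(d) (c z + d) ^ k f(z)` for all matrices in `Γ`, and is
meromorphic at all cusps. -/
structure IsModularFunction (k : ℤ) (Γ : Subgroup SL(2, ℤ)) {N : ℕ} (χ : DirichletCharacter ℂ N)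
    (f : ℍ → ℂ) : Prop where
  meromorphicOn : MeromorphicOn (fun z : ℂ => f (ofComplex z)) upperHalfPlaneSet
  slash_eq : ∀ γ ∈ Γ, f ∣[k] γ = χ ((γ 1 1 : ℤ) : ZMod N) • f
  meromorphicAtCusps : ∀ γ : SL(2, ℤ), IsMeromorphicAtInfty (f ∣[k] γ)

/-! The eta function has an explicit multiplier system on SL(2, ℤ): a Jacobi symbol times a power of
ζ = exp(2πi/24) (`hasEtaMultiplier_of_odd_left`, `hasEtaMultiplier_of_odd_right`). It is derived
from z ↦ z + 1 and z ↦ -1/z by a Euclidean descent on the lower row, with quadratic reciprocity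
accounting for the signs.

If γ = (a, b; Nc, d), then δ·γz is the image of δz under (a, bδ; cN/δ, d), whose automorphy factor
does not depend on δ. As the r_δ add up to 0, the square roots cancel. The exponents of ζ are affine
in bδ and cN/δ with coefficients free of δ, so they cancel once 24 divides b∑r_δ δ and c∑r_δ N/δ.
What remains is the product of Kronecker symbols (`etaProduct_moebius`).

Since g has no zeros, the cocycle relation for this factor shows that the sign is multiplicative and
periodic in d, which gives χ. Under congruences modulo 8 only, χ is obtained from 3r, which
satisfies them modulo 24 and has the same sign; Γ(6) supplies the missing factor 3 in b and c.

At the cusps no multiplier is needed: η^24 is modular, so by Hermite normal form the 24th power of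
g(γz) is a constant times that of a product of η((Az+B)/D)^r_δ. Two nonvanishing holomorphic
functions with proportional 24th powers are themselves proportional. -/

open scoped NumberTheorySymbols

/-! ### The 24th root of unity and the principal square root -/

/-- The primitive `24`-th root of unity `exp (2 π i / 24)`. -/
noncomputable def etaRoot : ℂ := Complex.exp (2 * Real.pi * Complex.I / 24)

lemma etaRoot_ne_zero : etaRoot ≠ 0 := Complex.exp_ne_zero _

lemma etaRoot_zpow (n : ℤ) : etaRoot ^ n = Complex.exp (2 * Real.pi * Complex.I / 24 * n) := by
  rw [etaRoot, ← Complex.exp_int_mul, mul_comm]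

lemma etaRoot_zpow_eq_one {n : ℤ} (h : 24 ∣ n) : etaRoot ^ n = 1 := by
  obtain ⟨k, rfl⟩ := h
  rw [etaRoot_zpow, Complex.exp_eq_one_iff]
  exact ⟨k, by push_cast; ring⟩

lemma etaRoot_zpow_congr {m n : ℤ} (h : 24 ∣ m - n) : etaRoot ^ m = etaRoot ^ n := by
  rw [← sub_add_cancel m n, zpow_add₀ etaRoot_ne_zero, etaRoot_zpow_eq_one h, one_mul]

lemma etaRoot_zpow_twelve : etaRoot ^ (12 : ℤ) = -1 := by
  rw [etaRoot_zpow, ← Complex.exp_pi_mul_I]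
  congr 1
  push_cast
  ring

lemma etaRoot_zpow_six : etaRoot ^ (6 : ℤ) = Complex.I := by
  rw [etaRoot_zpow]
  refine Eq.trans ?_ Complex.exp_pi_div_two_mul_I
  congr 1
  push_cast
  ring

lemma Complex.sqrt_I_eq_etaRoot_zpow : Complex.sqrt Complex.I = etaRoot ^ (3 : ℤ) := by
  rw [Complex.sqrt, Complex.cpow_def_of_ne_zero Complex.I_ne_zero, Complex.log_I, etaRoot_zpow]
  congr 1
  push_cast
  ring

lemma Complex.sqrt_mul_self (z : ℂ) : Complex.sqrt z * Complex.sqrt z = z := by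
  rw [← pow_two, Complex.sqrt]
  exact Complex.cpow_nat_inv_pow z (n := 2) two_ne_zero

lemma Complex.sqrt_ne_zero {z : ℂ} (hz : z ≠ 0) : Complex.sqrt z ≠ 0 := by
  intro h
  have := Complex.sqrt_mul_self z
  simp [h] at this
  exact hz this.symm

lemma Complex.sqrt_re_pos {z : ℂ} (hz : z ∈ Complex.slitPlane) : 0 < (Complex.sqrt z).re := by
  have h0 := Complex.slitPlane_ne_zero hz
  rw [Complex.sqrt, Complex.cpow_def_of_ne_zero h0, Complex.exp_re]
  have h1 := Complex.neg_pi_lt_arg z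
  have h2 := (Complex.arg_le_pi z).lt_of_ne (Complex.mem_slitPlane_iff_arg.1 hz).1
  refine mul_pos (Real.exp_pos _) (Real.cos_pos_of_mem_Ioo ?_)
  have : (Complex.log z * 2⁻¹).im = z.arg / 2 := by
    rw [show (2⁻¹ : ℂ) = ((2⁻¹ : ℝ) : ℂ) by norm_num, Complex.im_mul_ofReal, Complex.log_im]
    ring
  rw [this]
  constructor <;> linarith

lemma Complex.sqrt_im_pos {z : ℂ} (hz : 0 < z.im) : 0 < (Complex.sqrt z).im := by
  have h := Complex.sqrt_re_pos (Or.inr hz.ne')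
  have h2 := congrArg Complex.im (Complex.sqrt_mul_self z)
  rw [Complex.mul_im] at h2
  by_contra! h3
  nlinarith

/-- The sides agree up to sign. Both roots on the left lie in the open first quadrant, so their
product has positive imaginary part, as does the right side. -/
lemma Complex.sqrt_mul_of_im_pos {u z : ℂ} (hu : 0 < u.im) (hz : 0 < z.im) (huz : 0 < (u * z).im) :
    Complex.sqrt u * Complex.sqrt z = Complex.sqrt (u * z) := by
  have hsq : (sqrt u * sqrt z) ^ 2 = sqrt (u * z) ^ 2 := by
    rw [mul_pow, pow_two, pow_two, pow_two, sqrt_mul_self, sqrt_mul_self, sqrt_mul_self]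
  rcases sq_eq_sq_iff_eq_or_eq_neg.1 hsq with h | h
  · exact h
  · have h1 := sqrt_re_pos (Or.inr hu.ne')
    have h2 := sqrt_re_pos (Or.inr hz.ne')
    have h3 := sqrt_im_pos huz
    have h4 := congrArg Complex.im h
    rw [Complex.mul_im, Complex.neg_im] at h4
    nlinarith [mul_pos h1 (sqrt_im_pos hz), mul_pos h2 (sqrt_im_pos hu)]

/-- The same sign comparison: the imaginary part of the right side is the real part of a principal
root, hence positive. -/
lemma Complex.sqrt_mul_of_neg_mem_slitPlane {u z : ℂ} (hu : 0 < u.im) (hz : 0 < z.im)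
    (huz : -(u * z) ∈ Complex.slitPlane) :
    Complex.sqrt u * Complex.sqrt z = Complex.I * Complex.sqrt (-(u * z)) := by
  have hsq : (sqrt u * sqrt z) ^ 2 = (Complex.I * sqrt (-(u * z))) ^ 2 := by
    rw [mul_pow, mul_pow, pow_two, pow_two, pow_two (sqrt (-(u * z))), sqrt_mul_self,
      sqrt_mul_self, sqrt_mul_self, I_sq]
    ring
  rcases sq_eq_sq_iff_eq_or_eq_neg.1 hsq with h | h
  · exact h
  · have h1 := sqrt_re_pos (Or.inr hu.ne')
    have h2 := sqrt_re_pos (Or.inr hz.ne')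
    have h3 := sqrt_re_pos huz
    have h4 := congrArg Complex.im h
    rw [Complex.mul_im, Complex.neg_im, I_mul_im] at h4
    nlinarith [mul_pos h1 (sqrt_im_pos hz), mul_pos h2 (sqrt_im_pos hu)]

/-! ### Eta under translation and inversion -/

namespace ModularForm

lemma eta_add_one (z : ℂ) : η (z + 1) = etaRoot * η z := by
  have h (n : ℕ) : eta_q n (z + 1) = eta_q n z := by
    simp only [eta_q]
    congr 1
    rw [Function.Periodic.qParam, Function.Periodic.qParam, Complex.exp_eq_exp_iff_exists_int]
    exact ⟨1, by push_cast; ring⟩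
  simp only [eta, h, ← mul_assoc]
  congr 1
  rw [Function.Periodic.qParam, Function.Periodic.qParam, etaRoot, ← Complex.exp_add]
  congr 1
  push_cast
  ring

lemma eta_add_intCast (z : ℂ) (k : ℤ) : η (z + k) = etaRoot ^ k * η z := by
  induction k with
  | zero => simp
  | succ n ih =>
    push_cast at ih ⊢
    rw [← add_assoc, eta_add_one, ih, ← mul_assoc, zpow_add_one₀ etaRoot_ne_zero]
    ring
  | pred n ih =>
    have := eta_add_one (z + (-n - 1 : ℤ))
    rw [show z + (-n - 1 : ℤ) + 1 = z + (-n : ℤ) by push_cast; ring, ih] at this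
    rw [zpow_sub_one₀ etaRoot_ne_zero, mul_right_comm, this]
    field_simp [etaRoot_ne_zero]

lemma eta_neg_one_div {z : ℂ} (hz : 0 < z.im) :
    η (-1 / z) = etaRoot ^ (-3 : ℤ) * Complex.sqrt z * η z := by
  have := eta_comp_eq_csqrt_I_inv hz
  simp only [Function.comp_apply, Pi.smul_apply, Pi.mul_apply, smul_eq_mul] at this
  rw [this, Complex.sqrt_I_eq_etaRoot_zpow, zpow_neg]
  ring

end ModularForm

/-! ### The eta multiplier -/

lemma Complex.im_intCast_mul_add_intCast (c d : ℤ) (z : ℂ) :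
    ((c : ℂ) * z + d).im = c * z.im := by
  simp [Complex.mul_im]

lemma Complex.intCast_mul_add_intCast_ne_zero {a b c d : ℤ} (h : a * d - b * c = 1) {z : ℂ}
    (hz : 0 < z.im) : (c : ℂ) * z + d ≠ 0 := by
  intro h0
  have h1 := congrArg Complex.im h0
  rw [im_intCast_mul_add_intCast, Complex.zero_im] at h1
  have hc : c = 0 := by
    rcases mul_eq_zero.1 h1 with h1 | h1
    · exact_mod_cast h1
    · exact absurd h1 hz.ne'
  subst hc
  have hd : d = 0 := by simpa using h0
  simp [hd] at h

lemma Complex.im_moebius_pos {a b c d : ℤ} (h : a * d - b * c = 1) {z : ℂ} (hz : 0 < z.im) :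
    0 < (((a : ℂ) * z + b) / (c * z + d)).im := by
  have hne := intCast_mul_add_intCast_ne_zero h hz
  have hr : (a : ℝ) * d - b * c = 1 := by exact_mod_cast h
  rw [Complex.div_im, ← sub_div]
  refine div_pos ?_ (Complex.normSq_pos.2 hne)
  simp only [add_im, mul_im, intCast_re, intCast_im, add_re, mul_re]
  ring_nf
  nlinarith

lemma Complex.neg_one_div_im_pos {z : ℂ} (hz : 0 < z.im) : 0 < (-1 / z).im := by
  have := im_moebius_pos (a := 0) (b := -1) (c := 1) (d := 0) (by norm_num) hz
  simpa using this

/-- `η ((a z + b) / (c z + d)) = ε √(c z + d) η(z)` on the upper half plane, with the principal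
branch of the square root. -/
def HasEtaMultiplier (a b c d : ℤ) (ε : ℂ) : Prop :=
  ∀ z : ℂ, 0 < z.im → η (((a : ℂ) * z + b) / (c * z + d)) = ε * Complex.sqrt (c * z + d) * η z

namespace HasEtaMultiplier

variable {a b c d : ℤ} {ε : ℂ}

lemma translate (H : HasEtaMultiplier a b c d ε) (k : ℤ) :
    HasEtaMultiplier a (b + k * a) c (d + k * c) (ε * etaRoot ^ k) := by
  intro z hz
  have := H (z + k) (by simpa using hz)
  rw [ModularForm.eta_add_intCast] at this
  push_cast
  rw [show (a : ℂ) * z + (b + k * a) = a * (z + k) + b by ring,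
    show (c : ℂ) * z + (d + k * c) = c * (z + k) + d by ring, this]
  ring

/-- Factor (a, b; c, d) as (-b, a; -d, c) times z ↦ -1/z. The signs of c and d keep both automorphy
factors and their product in the upper half plane, so the roots multiply without correction. -/
lemma of_inversion_of_neg (h : a * d - b * c = 1) (hc : 0 < c) (hd : d < 0)
    (H : HasEtaMultiplier (-b) a (-d) c ε) :
    HasEtaMultiplier a b c d (ε * etaRoot ^ (-3 : ℤ)) := by
  intro z hz
  have hz0 : z ≠ 0 := by rintro rfl; simp at hz
  have hne := Complex.intCast_mul_add_intCast_ne_zero h hz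
  have hw := Complex.neg_one_div_im_pos hz
  have h1 := H (-1 / z) hw
  have hcR : (0 : ℝ) < c := by exact_mod_cast hc
  have hdR : (0 : ℝ) < (-d : ℤ) := by exact_mod_cast neg_pos.2 hd
  rw [ModularForm.eta_neg_one_div hz] at h1
  have e1 : (((-b : ℤ) : ℂ) * (-1 / z) + a) / ((-d : ℤ) * (-1 / z) + c) =
      ((a : ℂ) * z + b) / (c * z + d) := by
    have : ((-d : ℤ) : ℂ) * (-1 / z) + c = (c * z + d) / z := by push_cast; field_simp; ring
    rw [this]
    push_cast
    field_simp
    ring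
  have e2 : (((-d : ℤ) : ℂ) * (-1 / z) + c) * z = c * z + d := by push_cast; field_simp; ring
  have h3 := Complex.sqrt_mul_of_im_pos (u := ((-d : ℤ) : ℂ) * (-1 / z) + c) (z := z)
    (by rw [Complex.im_intCast_mul_add_intCast]; exact mul_pos hdR hw) hz
    (by rw [e2, Complex.im_intCast_mul_add_intCast]; exact mul_pos hcR hz)
  rw [e1] at h1
  rw [e2] at h3
  rw [h1, ← h3]
  ring

/-- Here the factor is (b, -a; d, -c), and the product of the automorphy factors is -(cz + d). The
resulting factor i = ζ^6 turns ζ^(-3) into ζ^3. -/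
lemma of_inversion_of_pos (h : a * d - b * c = 1) (hd : 0 < d)
    (H : HasEtaMultiplier b (-a) d (-c) ε) :
    HasEtaMultiplier a b c d (ε * etaRoot ^ (3 : ℤ)) := by
  intro z hz
  have hz0 : z ≠ 0 := by rintro rfl; simp at hz
  have hne := Complex.intCast_mul_add_intCast_ne_zero h hz
  have hw := Complex.neg_one_div_im_pos hz
  have h1 := H (-1 / z) hw
  have hdR : (0 : ℝ) < d := by exact_mod_cast hd
  rw [ModularForm.eta_neg_one_div hz] at h1
  have e1 : ((b : ℂ) * (-1 / z) + (-a : ℤ)) / (d * (-1 / z) + (-c : ℤ)) =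
      ((a : ℂ) * z + b) / (c * z + d) := by
    have : (d : ℂ) * (-1 / z) + (-c : ℤ) = -(c * z + d) / z := by push_cast; field_simp; ring
    rw [this]
    push_cast
    field_simp
    ring
  have e2 : -(((d : ℂ) * (-1 / z) + (-c : ℤ)) * z) = c * z + d := by push_cast; field_simp; ring
  have hs : (c : ℂ) * z + d ∈ Complex.slitPlane := by
    by_cases hc : c = 0
    · left
      simpa [hc] using hdR
    · right
      rw [Complex.im_intCast_mul_add_intCast]
      exact mul_ne_zero (by exact_mod_cast hc) hz.ne'
  have h3 := Complex.sqrt_mul_of_neg_mem_slitPlane (u := (d : ℂ) * (-1 / z) + (-c : ℤ)) (z := z)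
    (by rw [Complex.im_intCast_mul_add_intCast]; exact mul_pos hdR hw) hz (by rwa [e2])
  rw [e1] at h1
  rw [e2] at h3
  have h6 : etaRoot ^ (3 : ℤ) = etaRoot ^ (-3 : ℤ) * Complex.I := by
    rw [← etaRoot_zpow_six, ← zpow_add₀ etaRoot_ne_zero]
    norm_num
  rw [h1, h6]
  linear_combination ε * etaRoot ^ (-3 : ℤ) * η z * h3

end HasEtaMultiplier

lemma twentyFour_dvd_odd_mul_sq_sub_one {c : ℤ} (hc : Odd c) : 24 ∣ c * (c ^ 2 - 1) := by
  obtain ⟨m, rfl⟩ := hc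
  have : ∀ m : ZMod 24, (2 * m + 1) * ((2 * m + 1) ^ 2 - 1) = 0 := by decide
  refine (ZMod.intCast_zmod_eq_zero_iff_dvd _ 24).1 ?_
  push_cast
  exact this m

/-- The exponent of `exp (2 π i / 24)` in the multiplier of `η` when the lower left entry is
odd. -/
def etaExponent (a b c d : ℤ) : ℤ := (a + d) * c - b * d * (c ^ 2 - 1) - 3 * c

lemma neg_one_pow_eq_etaRoot_zpow (n : ℕ) : (-1 : ℂ) ^ n = etaRoot ^ (12 * n : ℤ) := by
  rw [zpow_mul, etaRoot_zpow_twelve, zpow_natCast]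

/-- Reciprocity with its sign written as a power of ζ^12 = -1, so that it merges with the exponent
of ζ in the descent. -/
lemma jacobiSym_neg_left_two_mul_add_one (m n : ℕ) :
    (J(-((2 * m + 1 : ℕ) : ℤ) | 2 * n + 1) : ℂ) =
      etaRoot ^ (12 * n * (m + 1) : ℤ) * J(((2 * n + 1 : ℕ) : ℤ) | 2 * m + 1) := by
  rw [jacobiSym.neg _ ⟨n, rfl⟩, ZMod.χ₄_eq_neg_one_pow (by lia),
    jacobiSym.quadratic_reciprocity ⟨m, rfl⟩ ⟨n, rfl⟩, ← mul_assoc, ← pow_add]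
  push_cast
  rw [neg_one_pow_eq_etaRoot_zpow, show (2 * n + 1) / 2 = n by lia,
    show (2 * m + 1) / 2 = m by lia]
  congr 2
  push_cast
  ring

lemma jacobiSym_two_mul_add_one (m n : ℕ) :
    (J(((2 * m + 1 : ℕ) : ℤ) | 2 * n + 1) : ℂ) =
      etaRoot ^ (12 * m * (n + 1) : ℤ) * J(-((2 * n + 1 : ℕ) : ℤ) | 2 * m + 1) := by
  rw [jacobiSym_neg_left_two_mul_add_one, ← mul_assoc, ← zpow_add₀ etaRoot_ne_zero,
    etaRoot_zpow_eq_one, one_mul]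
  exact ⟨m * (n + 1), by ring⟩

theorem hasEtaMultiplier_of_odd_left (c : ℕ) (hc : Odd c) (a b d : ℤ) (h : a * d - b * c = 1) :
    HasEtaMultiplier a b c d (J(d | c) * etaRoot ^ etaExponent a b c d) := by
  induction c using Nat.strong_induction_on generalizing a b d with
  | _ c ih =>
  have hcZ : Odd (c : ℤ) := by exact_mod_cast hc
  -- Translation allows d to be changed modulo c: the two exponents differ by a multiple of c(c² -
  -- 1), which 24 divides for odd c.
  have shift (k : ℤ) (H : HasEtaMultiplier a (b - k * a) c (d - k * c)
      (J(d - k * c | c) * etaRoot ^ etaExponent a (b - k * a) c (d - k * c))) :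
      HasEtaMultiplier a b c d (J(d | c) * etaRoot ^ etaExponent a b c d) := by
    have := H.translate k
    rw [sub_add_cancel, sub_add_cancel, mul_assoc, ← zpow_add₀ etaRoot_ne_zero,
      jacobiSym.mod_left' (a₂ := d) (by simp [Int.sub_emod])] at this
    convert! this using 2
    apply etaRoot_zpow_congr
    obtain ⟨t, ht⟩ := twentyFour_dvd_odd_mul_sq_sub_one hcZ
    refine ⟨- k * t * (2 * b - k * a), ?_⟩
    simp only [etaExponent]
    linear_combination (k - k * c ^ 2) * h - k * (2 * b - k * a) * ht
  have hc0 : 0 < c := hc.pos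
  rcases (Nat.succ_le_of_lt hc0).eq_or_lt with rfl | hc1
  · intro z hz
    have hb : b = a * d - 1 := by push_cast at h; linarith
    have hne : z + d ≠ 0 := by
      intro h0
      have := congrArg Complex.im h0
      simp [hz.ne'] at this
    have h1 := ModularForm.eta_neg_one_div (z := z + d) (by simpa using hz)
    have h2 := ModularForm.eta_add_intCast (-1 / (z + d)) a
    rw [h1, ModularForm.eta_add_intCast z] at h2
    have e1 : ((a : ℂ) * z + b) / ((1 : ℕ) * z + d) = -1 / (z + d) + a := by
      rw [hb]
      push_cast
      field_simp
      ring
    have e2 : etaExponent a b (1 : ℕ) d = a + (-3) + d := by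
      simp [etaExponent]
      ring
    simp only [Nat.succ_eq_add_one, zero_add, Int.cast_natCast] at e1 e2 ⊢
    rw [e1, h2, e2, jacobiSym.one_right, zpow_add₀ etaRoot_ne_zero, zpow_add₀ etaRoot_ne_zero]
    push_cast
    ring_nf
  · obtain ⟨m, hm⟩ := hc
    -- For odd d with |d| < c, inversion makes |d| the lower left entry, so the induction hypothesis
    -- applies.
    have key (a b d : ℤ) (h : a * d - b * c = 1) (hd : Odd d) (hlt : d.natAbs < c) :
        HasEtaMultiplier a b c d (J(d | c) * etaRoot ^ etaExponent a b c d) := by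
      rcases lt_or_ge d 0 with hneg | hpos
      · obtain ⟨e, rfl⟩ : ∃ e : ℕ, d = -e := ⟨d.natAbs, by omega⟩
        obtain ⟨n, hn⟩ : Odd e := by
          have := (Int.natAbs_odd.2 hd)
          simpa using this
        have H := (ih e (by simpa using hlt) ⟨n, hn⟩ (-b) a c (by linarith))
        have H' := HasEtaMultiplier.of_inversion_of_neg (a := a) (b := b) (c := c) (d := -e) h
          (by omega) hneg (by simpa using H)
        convert! H' using 1
        subst hn hm
        rw [jacobiSym_two_mul_add_one m n, mul_comm (etaRoot ^ _), mul_assoc, mul_assoc,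
          ← zpow_add₀ etaRoot_ne_zero, ← zpow_add₀ etaRoot_ne_zero]
        congr 1
        apply etaRoot_zpow_congr
        simp only [etaExponent]
        push_cast at h ⊢
        refine ⟨-(m * (n + 1)), ?_⟩
        linear_combination -((2 * m + 1 : ℤ) * (2 * n + 1)) * h
      · obtain ⟨e, rfl⟩ : ∃ e : ℕ, d = e := ⟨d.natAbs, by omega⟩
        obtain ⟨n, hn⟩ : Odd e := by exact_mod_cast hd
        have H := (ih e (by simpa using hlt) ⟨n, hn⟩ b (-a) (-c) (by linarith))
        have H' := HasEtaMultiplier.of_inversion_of_pos (a := a) (b := b) (c := c) (d := e) h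
          (by omega) (by simpa using H)
        convert! H' using 1
        subst hn hm
        rw [jacobiSym_neg_left_two_mul_add_one m n, mul_comm (etaRoot ^ _), mul_assoc, mul_assoc,
          ← zpow_add₀ etaRoot_ne_zero, ← zpow_add₀ etaRoot_ne_zero]
        congr 2
        simp only [etaExponent]
        push_cast at h ⊢
        linear_combination ((2 * m + 1 : ℤ) * (2 * n + 1)) * h
    have hr0 : 0 ≤ d % c := Int.emod_nonneg _ (by omega)
    have hr1 : d % c < c := Int.emod_lt_of_pos _ (by omega)
    have hr2 : d % c = d - d / c * c := by rw [Int.emod_def]; ring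
    -- As c is odd, one of the residues d % c and d % c - c is odd. A zero residue, for which the
    -- second would have absolute value c, is excluded by coprimality and c > 1.
    rcases Int.even_or_odd (d % c) with he | ho
    · have hne : d % c ≠ 0 := by
        intro h0
        obtain ⟨t, rfl⟩ := Int.dvd_of_emod_eq_zero h0
        have : (c : ℤ) ∣ 1 := ⟨a * t - b, by linarith⟩
        have := Int.le_of_dvd one_pos this
        omega
      refine shift (d / c + 1) (key _ _ _ (by linear_combination h) ?_ ?_)
      · rw [show d - (d / c + 1) * c = d % c - c by rw [hr2]; ring]
        exact he.sub_odd hcZ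
      · rw [show d - (d / c + 1) * c = d % c - c by rw [hr2]; ring]
        omega
    · refine shift (d / c) (key _ _ _ (by linear_combination h) ?_ ?_)
      · rwa [← hr2]
      · rw [← hr2]
        omega

theorem hasEtaMultiplier_of_odd_right (d : ℕ) (hd : Odd d) (a b c : ℤ) (h : a * d - b * c = 1) :
    HasEtaMultiplier a b c d
      (J(-c | d) * etaRoot ^ ((b - c) * d - a * c * (d ^ 2 - 1) - 3 * d + 3)) := by
  have H := hasEtaMultiplier_of_odd_left d hd b (-a) (-c) (by linarith)
  have H' := HasEtaMultiplier.of_inversion_of_pos (a := a) (b := b) (c := c) (d := d) h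
    (by exact_mod_cast hd.pos) H
  rw [mul_assoc, ← zpow_add₀ etaRoot_ne_zero] at H'
  convert! H' using 3
  simp only [etaExponent]
  ring

/-! ### Kronecker symbols and reciprocity -/

lemma kroneckerSymbol_natCast_of_ne_zero (a : ℕ) {n : ℤ} (hn : n ≠ 0) :
    kroneckerSymbol a n = ZMod.χ₈ (a : ZMod 8) ^ (n.natAbs.factorization 2) *
      J(a | n.natAbs / 2 ^ (n.natAbs.factorization 2)) := by
  have : ¬ (n < 0 ∧ (a : ℤ) < 0) := by omega
  simp [kroneckerSymbol, hn, this]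

lemma kroneckerSymbol_natCast_neg (a : ℕ) (n : ℤ) :
    kroneckerSymbol a (-n) = kroneckerSymbol a n := by
  rcases eq_or_ne n 0 with rfl | hn
  · simp
  · rw [kroneckerSymbol_natCast_of_ne_zero a hn,
      kroneckerSymbol_natCast_of_ne_zero a (neg_ne_zero.2 hn), Int.natAbs_neg]

lemma kroneckerSymbol_natCast_odd (a : ℕ) {n : ℕ} (hn : Odd n) :
    kroneckerSymbol a n = J(a | n) := by
  have h0 : (n : ℤ) ≠ 0 := by exact_mod_cast hn.pos.ne'
  have : n.factorization 2 = 0 :=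
    Nat.factorization_eq_zero_of_not_dvd hn.not_two_dvd_nat
  rw [kroneckerSymbol_natCast_of_ne_zero a h0]
  simp [this]

lemma kroneckerSymbol_pow_three (a n : ℤ) : kroneckerSymbol a n ^ 3 = kroneckerSymbol a n := by
  unfold kroneckerSymbol
  rcases eq_or_ne n 0 with rfl | hn
  · simp only [if_true]
    split_ifs <;> norm_num
  · rw [if_neg hn, mul_pow, mul_pow, ← pow_mul, mul_comm _ 3, pow_mul]
    congr 2
    · split_ifs <;> norm_num
    · congr 1
      rcases ZMod.isQuadratic_χ₈ (a : ZMod 8) with h | h | h <;> rw [h] <;> norm_num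
    · rcases jacobiSym.trichotomy a (n.natAbs / 2 ^ (n.natAbs.factorization 2)) with h | h | h <;>
        rw [h] <;> norm_num

/-- A form of quadratic reciprocity for the Kronecker symbol. -/
lemma exists_jacobiSym_eq_pow_mul_kroneckerSymbol {d : ℤ} (hd : d ≠ 0) :
    ∃ x : ℤ, (x = 1 ∨ x = -1) ∧ ∀ M : ℕ, Odd M → J(d | M) = x ^ (M / 2) * kroneckerSymbol M d := by
  have hd' : d.natAbs ≠ 0 := Int.natAbs_ne_zero.2 hd
  set v := d.natAbs.factorization 2 with hv
  set m := d.natAbs / 2 ^ v with hm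
  have hmul : 2 ^ v * m = d.natAbs := Nat.ordProj_mul_ordCompl_eq_self _ 2
  have hmo : Odd m := by
    rw [← Nat.not_even_iff_odd, even_iff_two_dvd]
    exact Nat.not_dvd_ordCompl Nat.prime_two hd'
  have habs (M : ℕ) (hM : Odd M) :
      J((d.natAbs : ℤ) | M) = ((-1) ^ (m / 2)) ^ (M / 2) * kroneckerSymbol M d := by
    rw [kroneckerSymbol_natCast_of_ne_zero M hd, ← hv, ← hm, ← hmul]
    push_cast
    rw [jacobiSym.mul_left, jacobiSym.pow_left, jacobiSym.at_two hM,
      jacobiSym.quadratic_reciprocity hmo hM, pow_mul]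
    ring
  rcases Int.natAbs_eq d with h | h
  · refine ⟨(-1) ^ (m / 2), neg_one_pow_eq_or ℤ _, fun M hM => ?_⟩
    rw [← habs M hM, ← h]
  · refine ⟨(-1) ^ (m / 2 + 1), neg_one_pow_eq_or ℤ _, fun M hM => ?_⟩
    have h1 : J(d | M) = (-1) ^ (M / 2) * J((d.natAbs : ℤ) | M) := by
      conv_lhs => rw [h]
      rw [jacobiSym.neg _ hM, ZMod.χ₄_eq_neg_one_pow (Nat.odd_iff.1 hM)]
    rw [h1, habs M hM, pow_succ, mul_pow]
    ring

/-! ### Transformation of eta-quotients -/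

lemma Finset.prod_zpow_eq_zpow_sum {ι G : Type*} [CommGroupWithZero G] (s : Finset ι) (f : ι → ℤ)
    {x : G} (hx : x ≠ 0) : ∏ i ∈ s, x ^ f i = x ^ ∑ i ∈ s, f i := by
  classical
  induction s using Finset.induction_on with
  | empty => simp
  | insert i s hi ih => rw [Finset.prod_insert hi, Finset.sum_insert hi, ih, zpow_add₀ hx]

lemma etaQuotientSign_neg (N : ℕ) (r : ℕ → ℤ) (d : ℤ) :
    etaQuotientSign N r (-d) = etaQuotientSign N r d := by
  simp only [etaQuotientSign, kroneckerSymbol_natCast_neg]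

lemma etaQuotientSign_three_mul (N : ℕ) (r : ℕ → ℤ) (d : ℤ) :
    etaQuotientSign N (fun δ => 3 * r δ) d = etaQuotientSign N r d := by
  refine Finset.prod_congr rfl fun δ _ => ?_
  rw [zpow_mul]
  congr 1
  exact_mod_cast kroneckerSymbol_pow_three _ d

lemma etaQuotientSign_of_odd (N : ℕ) (r : ℕ → ℤ) {d : ℕ} (hd : Odd d) :
    etaQuotientSign N r d = ∏ δ ∈ N.divisors, (J(((N / δ : ℕ) : ℤ) | d) : ℂ) ^ r δ := by
  simp only [etaQuotientSign, kroneckerSymbol_natCast_odd _ hd]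

/-- Reciprocity costs x^((M-1)/2) for M = N/δ, with a sign x independent of δ. Since the r_δ add up
to 0, the total exponent is half of ∑ r_δ N/δ, which is even. -/
lemma prod_jacobiSym_eq_etaQuotientSign {N : ℕ} (hN : Odd N) {r : ℕ → ℤ}
    (hr : ∑ δ ∈ N.divisors, r δ = 0) (h4 : 4 ∣ ∑ δ ∈ N.divisors, r δ * ((N / δ : ℕ) : ℤ))
    {d : ℤ} (hd : IsCoprime d N) :
    ∏ δ ∈ N.divisors, (J(d | N / δ) : ℂ) ^ r δ = etaQuotientSign N r d := by
  rcases eq_or_ne d 0 with rfl | hd0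
  · obtain rfl : N = 1 := by
      have := isCoprime_zero_left.1 hd
      simpa [Int.isUnit_iff] using this
    have : r 1 = 0 := by simpa using hr
    simp [etaQuotientSign, this]
  obtain ⟨x, hx, H⟩ := exists_jacobiSym_eq_pow_mul_kroneckerSymbol hd0
  have hodd : ∀ δ ∈ N.divisors, Odd (N / δ) := fun δ hδ =>
    hN.of_dvd_nat (Nat.div_dvd_of_dvd (Nat.dvd_of_mem_divisors hδ))
  have hx0 : (x : ℂ) ≠ 0 := by rcases hx with rfl | rfl <;> norm_num
  have key : ∏ δ ∈ N.divisors, (x : ℂ) ^ (((N / δ / 2 : ℕ) : ℤ) * r δ) = 1 := by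
    rw [Finset.prod_zpow_eq_zpow_sum _ _ hx0]
    have h2 : 2 * ∑ δ ∈ N.divisors, ((N / δ / 2 : ℕ) : ℤ) * r δ =
        ∑ δ ∈ N.divisors, r δ * ((N / δ : ℕ) : ℤ) := by
      rw [← sub_zero (∑ δ ∈ N.divisors, r δ * ((N / δ : ℕ) : ℤ)), ← hr, Finset.mul_sum,
        ← Finset.sum_sub_distrib]
      refine Finset.sum_congr rfl fun δ hδ => ?_
      have : ((N / δ : ℕ) : ℤ) = 2 * ((N / δ / 2 : ℕ) : ℤ) + 1 := by
        have := Nat.odd_iff.1 (hodd δ hδ)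
        omega
      rw [this]
      ring
    obtain ⟨k, hk⟩ : (2 : ℤ) ∣ ∑ δ ∈ N.divisors, ((N / δ / 2 : ℕ) : ℤ) * r δ := by omega
    rw [hk, zpow_mul]
    rcases hx with rfl | rfl <;> norm_num
  rw [etaQuotientSign, ← one_mul (∏ δ ∈ N.divisors, _), ← key, ← Finset.prod_mul_distrib]
  refine Finset.prod_congr rfl fun δ hδ => ?_
  have hsq : (x : ℂ) * x = 1 := by rcases hx with rfl | rfl <;> norm_num
  rw [H _ (hodd δ hδ), zpow_mul, ← mul_zpow, Int.cast_mul, Int.cast_pow, zpow_natCast, ← mul_assoc,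
    ← mul_pow, hsq, one_pow, one_mul]

/-- If every dilated factor transforms by a multiplier, an eta-quotient of weight `0` transforms by
their product. -/
lemma etaProduct_moebius_of_hasEtaMultiplier {N : ℕ} {r : ℕ → ℤ}
    (hr : ∑ δ ∈ N.divisors, r δ = 0) {a b c d : ℤ} (h : a * d - b * (N * c) = 1) {ε : ℕ → ℂ}
    (H : ∀ δ ∈ N.divisors, HasEtaMultiplier a (b * δ) (c * (N / δ : ℕ)) d (ε δ)) {z : ℂ}
    (hz : 0 < z.im) :
    ∏ δ ∈ N.divisors, η ((δ : ℂ) * (((a : ℂ) * z + b) / ((N * c : ℤ) * z + d))) ^ r δ =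
      (∏ δ ∈ N.divisors, ε δ ^ r δ) * ∏ δ ∈ N.divisors, η ((δ : ℂ) * z) ^ r δ := by
  have hne := Complex.intCast_mul_add_intCast_ne_zero h hz
  have hs := Complex.sqrt_ne_zero hne
  have h1 : ∏ δ ∈ N.divisors, Complex.sqrt ((N * c : ℤ) * z + d) ^ r δ = 1 := by
    rw [Finset.prod_zpow_eq_zpow_sum _ _ hs, hr, zpow_zero]
  rw [← mul_one (∏ δ ∈ N.divisors, ε δ ^ r δ), ← h1, ← Finset.prod_mul_distrib,
    ← Finset.prod_mul_distrib]
  refine Finset.prod_congr rfl fun δ hδ => ?_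
  have hδ0 : 0 < δ := Nat.pos_of_mem_divisors hδ
  have hmul : ((N / δ : ℕ) : ℂ) * δ = N := by
    exact_mod_cast Nat.div_mul_cancel (Nat.dvd_of_mem_divisors hδ)
  have := H δ hδ ((δ : ℂ) * z) (by simpa using mul_pos (by exact_mod_cast hδ0) hz)
  have e : ((c * (N / δ : ℕ) : ℤ) : ℂ) * (δ * z) + d = (N * c : ℤ) * z + d := by
    rw [Int.cast_mul, Int.cast_mul, Int.cast_natCast, Int.cast_natCast, ← hmul]
    ring
  rw [e] at this
  rw [← mul_zpow, ← mul_zpow, ← this]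
  congr 2
  push_cast
  ring

section

variable {N : ℕ} {r : ℕ → ℤ}

/-- The symbol (c/d) is nonzero and common to all δ, so its total exponent is ∑ r_δ = 0. -/
lemma prod_jacobiSym_mul_left_zpow (hr : ∑ δ ∈ N.divisors, r δ = 0) {c : ℤ} {d : ℕ}
    (h : IsCoprime c d) :
    ∏ δ ∈ N.divisors, (J(c * (N / δ : ℕ) | d) : ℂ) ^ r δ =
      ∏ δ ∈ N.divisors, (J(((N / δ : ℕ) : ℤ) | d) : ℂ) ^ r δ := by
  have hne : (J(c | d) : ℂ) ≠ 0 := by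
    exact_mod_cast jacobiSym.ne_zero (Int.isCoprime_iff_gcd_eq_one.1 h)
  simp only [jacobiSym.mul_left, Int.cast_mul, mul_zpow, Finset.prod_mul_distrib]
  rw [Finset.prod_zpow_eq_zpow_sum _ _ hne, hr, zpow_zero, one_mul]

lemma prod_jacobiSym_mul_right_zpow (hr : ∑ δ ∈ N.divisors, r δ = 0) {c : ℕ}
    (hc : c ≠ 0) {d : ℤ} (h : IsCoprime d c) :
    ∏ δ ∈ N.divisors, (J(d | c * (N / δ)) : ℂ) ^ r δ =
      ∏ δ ∈ N.divisors, (J(d | N / δ) : ℂ) ^ r δ := by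
  have hne : (J(d | c) : ℂ) ≠ 0 := by
    exact_mod_cast jacobiSym.ne_zero (Int.isCoprime_iff_gcd_eq_one.1 h)
  rw [← one_mul (∏ δ ∈ N.divisors, (J(d | N / δ) : ℂ) ^ r δ), ← zpow_zero (J(d | c) : ℂ), ← hr,
    ← Finset.prod_zpow_eq_zpow_sum _ _ hne, ← Finset.prod_mul_distrib]
  refine Finset.prod_congr rfl fun δ hδ => ?_
  rw [jacobiSym.mul_right' _ hc (Nat.div_pos (Nat.divisor_le hδ)
    (Nat.pos_of_mem_divisors hδ)).ne', Int.cast_mul, mul_zpow]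

lemma prod_etaRoot_zpow_eq_one {f : ℕ → ℤ} (h : 24 ∣ ∑ δ ∈ N.divisors, f δ * r δ) :
    ∏ δ ∈ N.divisors, (etaRoot ^ f δ) ^ r δ = 1 := by
  simp only [← zpow_mul]
  rw [Finset.prod_zpow_eq_zpow_sum _ _ etaRoot_ne_zero, etaRoot_zpow_eq_one h]

lemma twentyFour_dvd_sum_mul {b c : ℤ} (hr : ∑ δ ∈ N.divisors, r δ = 0)
    (hb : 24 ∣ b * ∑ δ ∈ N.divisors, r δ * (δ : ℤ))
    (hc : 24 ∣ c * ∑ δ ∈ N.divisors, r δ * ((N / δ : ℕ) : ℤ)) (A B C : ℤ) {f : ℕ → ℤ}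
    (hf : ∀ δ ∈ N.divisors, f δ = A * (b * δ) + B * (c * (N / δ : ℕ)) + C) :
    24 ∣ ∑ δ ∈ N.divisors, f δ * r δ := by
  obtain ⟨k, hk⟩ := hb
  obtain ⟨l, hl⟩ := hc
  refine ⟨A * k + B * l, ?_⟩
  calc ∑ δ ∈ N.divisors, f δ * r δ
      = ∑ δ ∈ N.divisors, (A * b * (r δ * δ) + B * c * (r δ * (N / δ : ℕ)) + C * r δ) :=
        Finset.sum_congr rfl fun δ hδ => by rw [hf δ hδ]; ring
    _ = _ := by
        rw [Finset.sum_add_distrib, Finset.sum_add_distrib, ← Finset.mul_sum, ← Finset.mul_sum,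
          ← Finset.mul_sum, hr]
        linear_combination A * hk + B * hl

lemma natCast_mul_natCast_div {δ : ℕ} (hδ : δ ∈ N.divisors) :
    (δ : ℤ) * ((N / δ : ℕ) : ℤ) = N := by
  exact_mod_cast Nat.mul_div_cancel' (Nat.dvd_of_mem_divisors hδ)

lemma etaProduct_moebius_of_odd_right (hr : ∑ δ ∈ N.divisors, r δ = 0) {a b c : ℤ} {d : ℕ}
    (hd : Odd d) (h : a * d - b * (N * c) = 1) (hb : 24 ∣ b * ∑ δ ∈ N.divisors, r δ * (δ : ℤ))
    (hc : 24 ∣ c * ∑ δ ∈ N.divisors, r δ * ((N / δ : ℕ) : ℤ)) {z : ℂ} (hz : 0 < z.im) :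
    ∏ δ ∈ N.divisors, η ((δ : ℂ) * (((a : ℂ) * z + b) / ((N * c : ℤ) * z + d))) ^ r δ =
      etaQuotientSign N r d * ∏ δ ∈ N.divisors, η ((δ : ℂ) * z) ^ r δ := by
  have H := etaProduct_moebius_of_hasEtaMultiplier hr h
    (fun δ hδ => hasEtaMultiplier_of_odd_right d hd a (b * δ) (c * (N / δ : ℕ))
      (by linear_combination h - b * c * natCast_mul_natCast_div hδ)) hz
  rw [Int.cast_natCast] at H
  rw [H]
  congr 1
  simp only [mul_zpow, Finset.prod_mul_distrib]
  rw [prod_etaRoot_zpow_eq_one (twentyFour_dvd_sum_mul hr hb hc d (-d - a * (d ^ 2 - 1))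
    (-3 * d + 3) fun δ _ => by ring), mul_one, etaQuotientSign_of_odd N r hd]
  simp only [← neg_mul]
  exact prod_jacobiSym_mul_left_zpow hr ⟨b * N, a, by linear_combination h⟩

lemma etaProduct_moebius_of_odd_left (hN : Odd N) (hr : ∑ δ ∈ N.divisors, r δ = 0)
    (h4 : 4 ∣ ∑ δ ∈ N.divisors, r δ * ((N / δ : ℕ) : ℤ)) {a b d : ℤ} {c : ℕ}
    (hco : Odd c) (h : a * d - b * (N * c) = 1) (hb : 24 ∣ b * ∑ δ ∈ N.divisors, r δ * (δ : ℤ))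
    (hc : 24 ∣ c * ∑ δ ∈ N.divisors, r δ * ((N / δ : ℕ) : ℤ)) {z : ℂ} (hz : 0 < z.im) :
    ∏ δ ∈ N.divisors, η ((δ : ℂ) * (((a : ℂ) * z + b) / ((N * c : ℤ) * z + d))) ^ r δ =
      etaQuotientSign N r d * ∏ δ ∈ N.divisors, η ((δ : ℂ) * z) ^ r δ := by
  have H := etaProduct_moebius_of_hasEtaMultiplier hr h
    (fun δ hδ => by
      have := hasEtaMultiplier_of_odd_left (c * (N / δ))
        (hco.mul (hN.of_dvd_nat (Nat.div_dvd_of_dvd (Nat.dvd_of_mem_divisors hδ)))) a (b * δ) d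
        (by rw [Nat.cast_mul]; linear_combination h - b * c * natCast_mul_natCast_div hδ)
      rwa [Nat.cast_mul] at this) hz
  rw [H]
  congr 1
  simp only [mul_zpow, Finset.prod_mul_distrib]
  -- The term bδ·(cN/δ)² of the exponent becomes linear in cN/δ because bδ·cN/δ = bcN.
  rw [prod_etaRoot_zpow_eq_one (twentyFour_dvd_sum_mul hr hb hc d (a + d - 3 - b * d * c * N) 0
    fun δ hδ => by
      rw [etaExponent]
      linear_combination - b * d * c ^ 2 * (N / δ : ℕ) * natCast_mul_natCast_div hδ), mul_one,
    prod_jacobiSym_mul_right_zpow hr hco.pos.ne' ⟨a, - b * N, by linear_combination h⟩]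
  exact prod_jacobiSym_eq_etaQuotientSign hN hr h4 ⟨a, - b * c, by linear_combination h⟩

/-- The transformation of an eta-quotient of weight `0` under a matrix `(a, b; N c, d)`. -/
theorem etaProduct_moebius (hr : ∑ δ ∈ N.divisors, r δ = 0)
    (h4 : 4 ∣ ∑ δ ∈ N.divisors, r δ * ((N / δ : ℕ) : ℤ)) {a b c d : ℤ}
    (h : a * d - b * (N * c) = 1) (hb : 24 ∣ b * ∑ δ ∈ N.divisors, r δ * (δ : ℤ))
    (hc : 24 ∣ c * ∑ δ ∈ N.divisors, r δ * ((N / δ : ℕ) : ℤ)) {z : ℂ} (hz : 0 < z.im) :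
    ∏ δ ∈ N.divisors, η ((δ : ℂ) * (((a : ℂ) * z + b) / ((N * c : ℤ) * z + d))) ^ r δ =
      etaQuotientSign N r d * ∏ δ ∈ N.divisors, η ((δ : ℂ) * z) ^ r δ := by
  have hneg : ((a : ℂ) * z + b) / ((N * c : ℤ) * z + d) =
      ((-a : ℤ) * z + (-b : ℤ)) / ((N * -c : ℤ) * z + (-d : ℤ)) := by
    rw [← neg_div_neg_eq]
    push_cast
    ring_nf
  have hb' : 24 ∣ -b * ∑ δ ∈ N.divisors, r δ * (δ : ℤ) := by rwa [neg_mul, dvd_neg]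
  have hc' : 24 ∣ -c * ∑ δ ∈ N.divisors, r δ * ((N / δ : ℕ) : ℤ) := by rwa [neg_mul, dvd_neg]
  have h' : -a * -d - -b * (N * -c) = 1 := by linear_combination h
  -- One of d and Nc is odd by the determinant. A negative odd entry is made positive by passing to
  -- -γ, which acts identically and has the same sign factor.
  rcases Int.even_or_odd d with hd | hd
  · have hNc : Odd ((N : ℤ) * c) := by
      by_contra hcon
      have := ((hd.mul_left a).sub ((Int.not_odd_iff_even.1 hcon).mul_left b))
      rw [h] at this
      exact absurd this (by decide)
    obtain ⟨hNo, hco⟩ := Int.odd_mul.1 hNc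
    have hNo' : Odd N := by exact_mod_cast hNo
    rcases le_or_gt 0 c with h0 | h0
    · lift c to ℕ using h0
      exact etaProduct_moebius_of_odd_left hNo' hr h4 (by exact_mod_cast hco) h hb hc hz
    · rw [hneg, ← etaQuotientSign_neg]
      obtain ⟨e, he⟩ := Int.eq_ofNat_of_zero_le (neg_nonneg.2 h0.le)
      rw [he] at hc' h' ⊢
      refine etaProduct_moebius_of_odd_left hNo' hr h4 ?_ h' hb' hc' hz
      have := hco.neg
      rw [he] at this
      exact_mod_cast this
  · rcases le_or_gt 0 d with h0 | h0
    · lift d to ℕ using h0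
      exact etaProduct_moebius_of_odd_right hr (by exact_mod_cast hd) h hb hc hz
    · rw [hneg, ← etaQuotientSign_neg]
      obtain ⟨e, he⟩ := Int.eq_ofNat_of_zero_le (neg_nonneg.2 h0.le)
      rw [he] at h' ⊢
      refine etaProduct_moebius_of_odd_right hr ?_ h' hb' hc' hz
      have := hd.neg
      rw [he] at this
      exact_mod_cast this

end

/-! ### The quadratic character -/

section

variable {N : ℕ} {r : ℕ → ℤ}

lemma etaQuotient_ne_zero (N : ℕ) (r : ℕ → ℤ) (z : ℍ) : etaQuotient N r z ≠ 0 := by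
  refine Finset.prod_ne_zero_iff.2 fun δ hδ => zpow_ne_zero _ (ModularForm.eta_ne_zero ?_)
  have : (0 : ℝ) < δ := by exact_mod_cast Nat.pos_of_mem_divisors hδ
  simpa [upperHalfPlaneSet] using mul_pos this z.im_pos

lemma UpperHalfPlane.coe_SL2Z_smul (γ : SL(2, ℤ)) (z : ℍ) :
    ((γ • z : ℍ) : ℂ) = ((γ 0 0 : ℂ) * z + γ 0 1) / (γ 1 0 * z + γ 1 1) := by
  rw [coe_specialLinearGroup_apply]
  simp

lemma Matrix.SpecialLinearGroup.det_fin_two_eq_one (γ : SL(2, ℤ)) :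
    γ 0 0 * γ 1 1 - γ 0 1 * γ 1 0 = 1 := by
  rw [← Matrix.det_fin_two, γ.det_coe]

theorem etaQuotient_smul (hr : ∑ δ ∈ N.divisors, r δ = 0)
    (h4 : 4 ∣ ∑ δ ∈ N.divisors, r δ * ((N / δ : ℕ) : ℤ)) {γ : SL(2, ℤ)} {c : ℤ}
    (hγ : γ 1 0 = N * c) (hb : 24 ∣ γ 0 1 * ∑ δ ∈ N.divisors, r δ * (δ : ℤ))
    (hc : 24 ∣ c * ∑ δ ∈ N.divisors, r δ * ((N / δ : ℕ) : ℤ)) (z : ℍ) :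
    etaQuotient N r (γ • z) = etaQuotientSign N r (γ 1 1) * etaQuotient N r z := by
  have h := γ.det_fin_two_eq_one
  rw [hγ] at h
  have := etaProduct_moebius hr h4 h hb hc z.im_pos
  simp only [etaQuotient]
  rw [← this, coe_SL2Z_smul, hγ]

lemma etaQuotientSign_one (N : ℕ) (r : ℕ → ℤ) : etaQuotientSign N r 1 = 1 := by
  have := etaQuotientSign_of_odd N r odd_one
  simpa using this

lemma etaQuotientSign_trichotomy (N : ℕ) (r : ℕ → ℤ) (d : ℤ) :
    etaQuotientSign N r d = 0 ∨ etaQuotientSign N r d = 1 ∨ etaQuotientSign N r d = -1 := by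
  have h : etaQuotientSign N r d ^ 3 = etaQuotientSign N r d := by
    rw [etaQuotientSign, ← Finset.prod_pow]
    refine Finset.prod_congr rfl fun δ _ => ?_
    rw [← zpow_natCast, zpow_comm, zpow_natCast]
    congr 1
    exact_mod_cast kroneckerSymbol_pow_three _ d
  have h2 : etaQuotientSign N r d * ((etaQuotientSign N r d - 1) * (etaQuotientSign N r d + 1)) = 0 := by
    linear_combination h
  rcases mul_eq_zero.1 h2 with h | h
  · exact .inl h
  rcases mul_eq_zero.1 h with h | h
  · exact .inr (.inl (sub_eq_zero.1 h))
  · exact .inr (.inr (eq_neg_of_add_eq_zero_left h))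

lemma exists_SL2Z_bottom_row {c d : ℤ} (h : IsCoprime d c) :
    ∃ γ : SL(2, ℤ), γ 1 0 = c ∧ γ 1 1 = d := by
  obtain ⟨a, b, hab⟩ := h
  exact ⟨⟨!![a, -b; c, d], by rw [Matrix.det_fin_two_of]; linear_combination hab⟩, by simp, by simp⟩

theorem exists_dirichletCharacter_eq_etaQuotientSign (hr : ∑ δ ∈ N.divisors, r δ = 0)
    (h1 : 24 ∣ ∑ δ ∈ N.divisors, r δ * (δ : ℤ))
    (h2 : 24 ∣ ∑ δ ∈ N.divisors, r δ * ((N / δ : ℕ) : ℤ)) :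
    ∃ χ : DirichletCharacter ℂ N, MulChar.IsQuadratic χ ∧
      ∀ d : ℤ, IsCoprime d (N : ℤ) → χ (d : ZMod N) = etaQuotientSign N r d := by
  have law (γ : SL(2, ℤ)) (hγ : (N : ℤ) ∣ γ 1 0) (z : ℍ) :
      etaQuotient N r (γ • z) = etaQuotientSign N r (γ 1 1) * etaQuotient N r z := by
    obtain ⟨c, hc⟩ := hγ
    exact etaQuotient_smul hr (Dvd.dvd.trans (by norm_num) h2) hc (h1.mul_left _) (h2.mul_left _) z
  have mul (γ γ' : SL(2, ℤ)) (hγ : (N : ℤ) ∣ γ 1 0) (hγ' : (N : ℤ) ∣ γ' 1 0) :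
      etaQuotientSign N r ((γ * γ') 1 1) =
        etaQuotientSign N r (γ 1 1) * etaQuotientSign N r (γ' 1 1) := by
    have hmul : (N : ℤ) ∣ (γ * γ') 1 0 := by
      rw [Matrix.SpecialLinearGroup.coe_mul, Matrix.mul_apply, Fin.sum_univ_two]
      exact dvd_add (hγ.mul_right _) (hγ'.mul_left _)
    have := law (γ * γ') hmul I
    rw [mul_smul, law γ hγ, law γ' hγ', ← mul_assoc] at this
    exact (mul_right_cancel₀ (etaQuotient_ne_zero N r I) this).symm
  -- Right multiplication by T^k adds kN to the lower right entry of a matrix with lower row (N, d),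
  -- and T^k itself has sign 1.
  have congr (d e : ℤ) (hd : IsCoprime d (N : ℤ)) (hde : (d : ZMod N) = e) :
      etaQuotientSign N r d = etaQuotientSign N r e := by
    obtain ⟨k, hk⟩ := (ZMod.intCast_eq_intCast_iff_dvd_sub d e N).1 hde
    obtain ⟨γ, hc, rfl⟩ := exists_SL2Z_bottom_row hd
    have := mul γ (ModularGroup.T ^ k) (by simp [hc]) (by simp [ModularGroup.coe_T_zpow])
    rw [Matrix.SpecialLinearGroup.coe_mul, Matrix.mul_apply, Fin.sum_univ_two, hc,
      ModularGroup.coe_T_zpow] at this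
    simp only [Matrix.of_apply, Matrix.cons_val', Matrix.cons_val_one, Matrix.cons_val_zero,
      Matrix.cons_val_fin_one, mul_one, etaQuotientSign_one] at this
    rw [← this]
    congr 1
    linear_combination -hk
  have cop (u : (ZMod N)ˣ) : IsCoprime ((u : ZMod N).cast : ℤ) (N : ℤ) := by
    refine ((ZMod.coe_int_isUnit_iff_isCoprime _ N).1 ?_).symm
    rw [ZMod.intCast_zmod_cast]
    exact u.isUnit
  let f : (ZMod N)ˣ →* ℂ :=
    { toFun := fun u => etaQuotientSign N r ((u : ZMod N).cast : ℤ)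
      map_one' := by
        rw [← etaQuotientSign_one N r]
        exact congr _ _ (cop 1) (by simp)
      map_mul' := fun u v => by
        obtain ⟨γ, hc, hd⟩ := exists_SL2Z_bottom_row (cop u)
        obtain ⟨γ', hc', hd'⟩ := exists_SL2Z_bottom_row (cop v)
        rw [← hd, ← hd', ← mul γ γ' (by simp [hc]) (by simp [hc'])]
        refine congr _ _ (cop _) ?_
        rw [Matrix.SpecialLinearGroup.coe_mul, Matrix.mul_apply, Fin.sum_univ_two, hc, hd, hd']
        simp }
  let χ : DirichletCharacter ℂ N := MulChar.ofUnitHom f.toHomUnits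
  have hχ (u : (ZMod N)ˣ) : χ u = etaQuotientSign N r ((u : ZMod N).cast : ℤ) :=
    MulChar.ofUnitHom_coe _ u
  refine ⟨χ, fun x => ?_, fun d hd => ?_⟩
  · by_cases hx : IsUnit x
    · obtain ⟨u, rfl⟩ := hx
      rw [hχ]
      exact etaQuotientSign_trichotomy _ _ _
    · exact .inl (χ.map_nonunit hx)
  · obtain ⟨u, hu⟩ := (ZMod.coe_int_isUnit_iff_isCoprime d N).2 hd.symm
    rw [← hu, hχ]
    exact congr _ _ (cop u) (by rw [ZMod.intCast_zmod_cast, hu])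

end

/-! ### Meromorphy at the cusps and on the half plane -/

lemma ModularForm.eta_moebius_pow_twentyFour {a b c d : ℤ} (h : a * d - b * c = 1) {z : ℂ}
    (hz : 0 < z.im) :
    η (((a : ℂ) * z + b) / (c * z + d)) ^ 24 = (c * z + d) ^ 12 * η z ^ 24 := by
  let γ : SL(2, ℤ) := ⟨!![a, b; c, d], by rw [Matrix.det_fin_two_of, h]⟩
  have h1 := congrFun (SlashInvariantForm.slash_action_generators_SL2Z discriminant_S_invariant
    discriminant_T_invariant γ) ⟨z, hz⟩
  have h2 := (slash_action_eq'_iff 12 discriminant γ ⟨z, hz⟩).1 h1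
  simp only [discriminant, coe_SL2Z_smul] at h2
  simpa [γ] using h2

/-- Hermite normal form: `δ (a z + b) / (c z + d)` is, up to `SL(2, ℤ)`, of the form
`(A z + B) / D`. -/
lemma exists_eta_mul_moebius_pow_twentyFour {a b c d : ℤ} (h : a * d - b * c = 1) {δ : ℕ}
    (hδ : 0 < δ) : ∃ (A D : ℕ) (B : ℤ), A * D = δ ∧ ∀ z : ℂ, 0 < z.im →
      η ((δ : ℂ) * (((a : ℂ) * z + b) / (c * z + d))) ^ 24 =
        ((D : ℂ)⁻¹ * (c * z + d)) ^ 12 * η ((A * z + B) / D) ^ 24 := by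
  have hA0 : Int.gcd (δ * a) c ≠ 0 := by
    intro h0
    obtain ⟨h1, h2⟩ := Int.gcd_eq_zero_iff.1 h0
    have ha : a = 0 := by
      rcases mul_eq_zero.1 h1 with h1 | h1
      · omega
      · exact h1
    simp [ha, h2] at h
  -- The first column of (δa, δb; c, d) is A(p, s). Completing (p, s) to (p, -v; s, u) of
  -- determinant 1 factors the matrix as (p, -v; s, u)(A, B; 0, D).
  set A := Int.gcd (δ * a) c with hA
  obtain ⟨p, hp⟩ : (A : ℤ) ∣ δ * a := Int.gcd_dvd_left ..
  obtain ⟨s, hs⟩ : (A : ℤ) ∣ c := Int.gcd_dvd_right ..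
  obtain ⟨u, v, huv⟩ : ∃ u v : ℤ, δ * a * u + c * v = A :=
    ⟨_, _, (Int.gcd_eq_gcd_ab (δ * a) c).symm⟩
  have hAZ : (A : ℤ) ≠ 0 := by exact_mod_cast hA0
  have hdet : p * u - -v * s = 1 := by
    apply mul_left_cancel₀ hAZ
    linear_combination huv - u * hp - v * hs
  have hAD : (A : ℤ) * (p * d - s * δ * b) = δ := by
    linear_combination (δ : ℤ) * h - d * hp + δ * b * hs
  have hD0 : 0 < p * d - s * δ * b := by
    refine pos_of_mul_pos_right (a := (A : ℤ)) ?_ (by positivity)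
    rw [hAD]
    exact_mod_cast hδ
  obtain ⟨D, hD⟩ := Int.eq_ofNat_of_zero_le hD0.le
  rw [hD] at hAD hD0
  have hDpos : 0 < D := by exact_mod_cast hD0
  have hAD' : A * D = δ := by exact_mod_cast hAD
  refine ⟨A, D, u * δ * b + v * d, hAD', fun z hz => ?_⟩
  set B := u * δ * b + v * d with hB
  have hDC : (D : ℂ) ≠ 0 := by exact_mod_cast hDpos.ne'
  have hAR : (0 : ℝ) < A := by exact_mod_cast Nat.pos_of_ne_zero hA0
  have hDR : (0 : ℝ) < D := by exact_mod_cast hDpos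
  have him : 0 < (((A : ℂ) * z + B) / D).im := by
    have := Complex.im_intCast_mul_add_intCast A B z
    rw [Int.cast_natCast] at this
    rw [Complex.div_natCast_im, this]
    push_cast
    positivity
  have e1 : (s : ℂ) * ((A * z + B) / D) + u = (D : ℂ)⁻¹ * (c * z + d) := by
    have h1 : s * B + u * D = d := by
      linear_combination s * hB - u * hD + d * hdet
    have h1' : (s : ℂ) * B + u * D = d := by exact_mod_cast h1
    have hs' : (c : ℂ) = A * s := by exact_mod_cast hs
    field_simp
    linear_combination h1' - z * hs'
  have e2 : (p : ℂ) * ((A * z + B) / D) + (-v : ℤ) = (D : ℂ)⁻¹ * (δ * (a * z + b)) := by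
    have h1 : p * B - v * D = δ * b := by
      linear_combination p * hB + v * hD + δ * b * hdet
    have h1' : (p : ℂ) * B - v * D = δ * b := by exact_mod_cast h1
    have hp' : (δ : ℂ) * a = A * p := by exact_mod_cast hp
    push_cast
    field_simp
    linear_combination h1' - z * hp'
  have key := ModularForm.eta_moebius_pow_twentyFour hdet him
  rw [e1, e2] at key
  rw [← key, mul_div_mul_left _ _ (inv_ne_zero hDC), mul_div_assoc]

/-- Proportional n-th powers have equal logarithmic derivatives; dividing by n gives those of f and
g, which determine each function up to a constant on a connected set. -/
lemma exists_eqOn_const_mul_of_pow_eq {s : Set ℂ} (hs : IsOpen s) (hs' : IsPreconnected s)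
    {f g : ℂ → ℂ} (hf : DifferentiableOn ℂ f s) (hg : DifferentiableOn ℂ g s)
    (hf0 : ∀ z ∈ s, f z ≠ 0) (hg0 : ∀ z ∈ s, g z ≠ 0) {n : ℕ} (hn : n ≠ 0) {C : ℂ} (hC : C ≠ 0)
    (h : ∀ z ∈ s, f z ^ n = C * g z ^ n) : ∃ K : ℂ, ∀ z ∈ s, f z = K * g z := by
  obtain ⟨K, -, hK⟩ := (logDeriv_eqOn_iff hf hg hs hs' hg0 hf0).1 fun z hz => by
    have hz' := hs.mem_nhds hz
    have h1 : logDeriv (fun z => f z ^ n) z = logDeriv (fun z => C * g z ^ n) z := by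
      have he : (fun z => f z ^ n) =ᶠ[nhds z] fun z => C * g z ^ n :=
        Filter.eventually_of_mem hz' h
      rw [logDeriv_apply, logDeriv_apply, he.deriv_eq, h z hz]
    rw [logDeriv_const_mul _ _ hC, logDeriv_fun_pow (hf.differentiableAt hz'),
      logDeriv_fun_pow (hg.differentiableAt hz')] at h1
    exact mul_left_cancel₀ (by exact_mod_cast hn) h1
  exact ⟨K, fun z hz => by simpa using hK hz⟩

lemma differentiableOn_prod_eta_comp_zpow {ι : Type*} (s : Finset ι) (r : ι → ℤ) {w : ι → ℂ → ℂ}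
    (hw : ∀ i ∈ s, DifferentiableOn ℂ (w i) upperHalfPlaneSet)
    (hw' : ∀ i ∈ s, ∀ z ∈ upperHalfPlaneSet, w i z ∈ upperHalfPlaneSet) :
    DifferentiableOn ℂ (fun z => ∏ i ∈ s, η (w i z) ^ r i) upperHalfPlaneSet := by
  refine DifferentiableOn.fun_finsetProd fun i hi z hz => ?_
  refine DifferentiableWithinAt.zpow ?_ (.inl (ModularForm.eta_ne_zero (hw' i hi z hz)))
  exact (ModularForm.differentiableAt_eta_of_mem_upperHalfPlaneSet
    (hw' i hi z hz)).comp_differentiableWithinAt z (hw i hi z hz)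

/-- `η ((A z + B) / D)` as a function of `exp (2 π i z / (24 D M))`. -/
lemma exists_analyticAt_eta_eq_qParam {A D M : ℕ} (hA : 0 < A) (hD : 0 < D) (hM : 0 < M) (B : ℤ) :
    ∃ Φ : ℂ → ℂ, AnalyticAt ℂ Φ 0 ∧
      ∀ z : ℂ, η ((A * z + B) / D) = Φ (Function.Periodic.qParam ((24 * (D * M) : ℕ) : ℝ) z) := by
  let P : ℂ → ℂ := fun q => ∏' n : ℕ, (1 - q ^ (n + 1))
  have hP : AnalyticAt ℂ P 0 := ModularForm.differentiableOn_tprod_one_sub_pow.analyticAt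
    (Metric.ball_mem_nhds _ one_pos)
  have hDC : (D : ℂ) ≠ 0 := by exact_mod_cast hD.ne'
  have hMC : (M : ℂ) ≠ 0 := by exact_mod_cast hM.ne'
  refine ⟨fun q => Function.Periodic.qParam 24 (B / D) * q ^ (A * M) *
    P (Function.Periodic.qParam 1 (B / D) * q ^ (24 * (A * M))), ?_, fun z => ?_⟩
  · refine AnalyticAt.mul (by fun_prop) (AnalyticAt.fun_comp ?_ (by fun_prop))
    rwa [zero_pow (by positivity), mul_zero]
  · have h1 : Function.Periodic.qParam 24 ((A * z + B) / D) = Function.Periodic.qParam 24 (B / D) *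
        Function.Periodic.qParam ((24 * (D * M) : ℕ) : ℝ) z ^ (A * M) := by
      simp only [Function.Periodic.qParam]
      rw [← Complex.exp_nat_mul, ← Complex.exp_add]
      congr 1
      push_cast
      field_simp
      ring
    have h2 : Function.Periodic.qParam 1 ((A * z + B) / D) = Function.Periodic.qParam 1 (B / D) *
        Function.Periodic.qParam ((24 * (D * M) : ℕ) : ℝ) z ^ (24 * (A * M)) := by
      simp only [Function.Periodic.qParam]
      rw [← Complex.exp_nat_mul, ← Complex.exp_add]
      congr 1
      push_cast
      field_simp
      ring
    simp only [ModularForm.eta, ModularForm.eta_q, h1, h2, P]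

section

variable {N : ℕ} {r : ℕ → ℤ}

theorem isMeromorphicAtInfty_etaQuotient_slash (hN : 0 < N) (hr : ∑ δ ∈ N.divisors, r δ = 0)
    (γ : SL(2, ℤ)) : IsMeromorphicAtInfty (etaQuotient N r ∣[(0 : ℤ)] γ) := by
  have hdet := γ.det_fin_two_eq_one
  have hex (δ : ℕ) : ∃ (A D : ℕ) (B : ℤ), δ ∈ N.divisors → (A * D = δ ∧ ∀ z : ℂ, 0 < z.im →
      η ((δ : ℂ) * (((γ 0 0 : ℂ) * z + γ 0 1) / (γ 1 0 * z + γ 1 1))) ^ 24 =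
        ((D : ℂ)⁻¹ * (γ 1 0 * z + γ 1 1)) ^ 12 * η ((A * z + B) / D) ^ 24) := by
    by_cases hδ : δ ∈ N.divisors
    · obtain ⟨A, D, B, h⟩ :=
        exists_eta_mul_moebius_pow_twentyFour hdet (Nat.pos_of_mem_divisors hδ)
      exact ⟨A, D, B, fun _ => h⟩
    · exact ⟨0, 0, 0, fun h => absurd h hδ⟩
  choose A D B hAD using hex
  have hA0 (δ) (hδ : δ ∈ N.divisors) : 0 < A δ :=
    Nat.pos_of_mul_pos_right ((hAD δ hδ).1 ▸ Nat.pos_of_mem_divisors hδ)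
  have hD0 (δ) (hδ : δ ∈ N.divisors) : 0 < D δ :=
    Nat.pos_of_mul_pos_left ((hAD δ hδ).1 ▸ Nat.pos_of_mem_divisors hδ)
  have hDN (δ) (hδ : δ ∈ N.divisors) : D δ * (N / D δ) = N :=
    Nat.mul_div_cancel' ((Dvd.intro_left _ (hAD δ hδ).1).trans (Nat.dvd_of_mem_divisors hδ))
  let f : ℂ → ℂ := fun z =>
    ∏ δ ∈ N.divisors, η ((δ : ℂ) * (((γ 0 0 : ℂ) * z + γ 0 1) / (γ 1 0 * z + γ 1 1))) ^ r δ
  let g : ℂ → ℂ := fun z => ∏ δ ∈ N.divisors, η ((A δ * z + B δ) / D δ) ^ r δ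
  have hfim (δ) (hδ : δ ∈ N.divisors) (z : ℂ) (hz : z ∈ upperHalfPlaneSet) :
      (δ : ℂ) * (((γ 0 0 : ℂ) * z + γ 0 1) / (γ 1 0 * z + γ 1 1)) ∈ upperHalfPlaneSet := by
    have : (0 : ℝ) < δ := by exact_mod_cast Nat.pos_of_mem_divisors hδ
    have h2 := Complex.im_moebius_pos hdet hz
    change 0 < Complex.im _
    rw [← Complex.ofReal_natCast, Complex.im_ofReal_mul]
    positivity
  have hgim (δ) (hδ : δ ∈ N.divisors) (z : ℂ) (hz : z ∈ upperHalfPlaneSet) :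
      ((A δ : ℂ) * z + B δ) / D δ ∈ upperHalfPlaneSet := by
    have h1 : (0 : ℝ) < A δ := by exact_mod_cast hA0 δ hδ
    have h2 : (0 : ℝ) < D δ := by exact_mod_cast hD0 δ hδ
    have h3 := Complex.im_intCast_mul_add_intCast (A δ) (B δ) z
    rw [Int.cast_natCast] at h3
    change 0 < Complex.im _
    rw [Complex.div_natCast_im, h3]
    have h4 : 0 < z.im := hz
    push_cast
    positivity
  have hf : DifferentiableOn ℂ f upperHalfPlaneSet := by
    refine differentiableOn_prod_eta_comp_zpow _ _ (fun δ _ => ?_) hfim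
    have (z : ℂ) (hz : z ∈ upperHalfPlaneSet) := Complex.intCast_mul_add_intCast_ne_zero hdet hz
    fun_prop (disch := assumption)
  have hg : DifferentiableOn ℂ g upperHalfPlaneSet :=
    differentiableOn_prod_eta_comp_zpow _ _ (fun δ _ => by fun_prop) hgim
  have hDne : ∏ δ ∈ N.divisors, (((D δ : ℂ)⁻¹) ^ 12) ^ r δ ≠ 0 :=
    Finset.prod_ne_zero_iff.2 fun δ hδ => zpow_ne_zero _ (pow_ne_zero _ (inv_ne_zero
      (by exact_mod_cast (hD0 δ hδ).ne')))
  obtain ⟨K, hK⟩ := exists_eqOn_const_mul_of_pow_eq isOpen_upperHalfPlaneSet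
    (convex_halfSpace_im_gt 0).isPreconnected hf hg
    (fun z hz => Finset.prod_ne_zero_iff.2 fun δ hδ =>
      zpow_ne_zero _ (ModularForm.eta_ne_zero (hfim δ hδ z hz)))
    (fun z hz => Finset.prod_ne_zero_iff.2 fun δ hδ =>
      zpow_ne_zero _ (ModularForm.eta_ne_zero (hgim δ hδ z hz)))
    (n := 24) (by norm_num) hDne fun z hz => by
      have hj : ((γ 1 0 : ℂ) * z + γ 1 1) ^ 12 ≠ 0 :=
        pow_ne_zero _ (Complex.intCast_mul_add_intCast_ne_zero hdet hz)
      have h1 : ∏ δ ∈ N.divisors, (((γ 1 0 : ℂ) * z + γ 1 1) ^ 12) ^ r δ = 1 := by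
        rw [Finset.prod_zpow_eq_zpow_sum _ _ hj, hr, zpow_zero]
      rw [← mul_one (∏ δ ∈ N.divisors, _ ^ r δ), ← h1]
      simp only [f, g, ← Finset.prod_pow, ← Finset.prod_mul_distrib]
      refine Finset.prod_congr rfl fun δ hδ => ?_
      have hcomm (x : ℂ) : (x ^ r δ) ^ 24 = (x ^ 24) ^ r δ := by
        rw [← zpow_natCast, zpow_comm, zpow_natCast]
      rw [hcomm, hcomm, (hAD δ hδ).2 z hz, mul_pow, mul_zpow, mul_zpow]
  have hΦ (δ : ℕ) : ∃ Φ : ℂ → ℂ, δ ∈ N.divisors → (AnalyticAt ℂ Φ 0 ∧ ∀ z : ℂ,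
      η ((A δ * z + B δ) / D δ) = Φ (Function.Periodic.qParam ((24 * N : ℕ) : ℝ) z)) := by
    by_cases hδ : δ ∈ N.divisors
    · have hM : 0 < N / D δ := Nat.pos_of_mul_pos_left ((hDN δ hδ).symm ▸ hN)
      obtain ⟨Φ, h⟩ := exists_analyticAt_eta_eq_qParam (hA0 δ hδ) (hD0 δ hδ) hM (B δ)
      rw [hDN δ hδ] at h
      exact ⟨Φ, fun _ => h⟩
    · exact ⟨0, fun h => absurd h hδ⟩
  choose Φ hΦ using hΦ
  -- Every D_δ divides N, so taking M = N / D_δ makes all factors functions of the same parameter,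
  -- of width 24N.
  refine ⟨24 * N, by positivity, fun q => K * ∏ δ ∈ N.divisors, Φ δ q ^ r δ, ?_,
    Filter.Eventually.of_forall fun z => ?_⟩
  · exact (MeromorphicAt.const K 0).fun_mul
      (MeromorphicAt.fun_prod fun δ hδ => (hΦ δ hδ).1.meromorphicAt.zpow _)
  · rw [ModularForm.SL_slash_apply, neg_zero, zpow_zero, mul_one, etaQuotient, coe_SL2Z_smul]
    refine (hK z z.im_pos).trans ?_
    congr 1
    exact Finset.prod_congr rfl fun δ hδ => by rw [(hΦ δ hδ).2]

theorem meromorphicOn_etaQuotient (N : ℕ) (r : ℕ → ℤ) :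
    MeromorphicOn (fun z : ℂ => etaQuotient N r (ofComplex z)) upperHalfPlaneSet := by
  have h : DifferentiableOn ℂ (fun z : ℂ => etaQuotient N r (ofComplex z)) upperHalfPlaneSet := by
    refine (differentiableOn_prod_eta_comp_zpow N.divisors r (w := fun δ z => (δ : ℂ) * z)
      (fun δ _ => by fun_prop) fun δ hδ z hz => ?_).congr fun z hz => ?_
    · have : (0 : ℝ) < δ := by exact_mod_cast Nat.pos_of_mem_divisors hδ
      change 0 < Complex.im _
      rw [← Complex.ofReal_natCast, Complex.im_ofReal_mul]
      exact mul_pos this hz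
    · simp [etaQuotient, ofComplex_apply_of_im_pos hz]
  exact fun z hz => (h.analyticAt (isOpen_upperHalfPlaneSet.mem_nhds hz)).meromorphicAt

/-- A criterion for an eta-quotient to be a modular function of weight `0`. -/
theorem isModularFunction_etaQuotient (hN : 0 < N) (hr : ∑ δ ∈ N.divisors, r δ = 0)
    (h4 : 4 ∣ ∑ δ ∈ N.divisors, r δ * ((N / δ : ℕ) : ℤ)) {Γ : Subgroup SL(2, ℤ)}
    {χ : DirichletCharacter ℂ N}
    (hχ : ∀ d : ℤ, IsCoprime d (N : ℤ) → χ (d : ZMod N) = etaQuotientSign N r d)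
    (hΓ : ∀ γ ∈ Γ, 24 ∣ γ 0 1 * ∑ δ ∈ N.divisors, r δ * (δ : ℤ) ∧ ∃ c, γ 1 0 = N * c ∧
      24 ∣ c * ∑ δ ∈ N.divisors, r δ * ((N / δ : ℕ) : ℤ)) :
    IsModularFunction 0 Γ χ (etaQuotient N r) where
  meromorphicOn := meromorphicOn_etaQuotient N r
  slash_eq γ hγ := by
    obtain ⟨hb, c, hγc, hc⟩ := hΓ γ hγ
    ext z
    have hdet := γ.det_fin_two_eq_one
    rw [hγc] at hdet
    rw [ModularForm.SL_slash_apply, neg_zero, zpow_zero, mul_one,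
      etaQuotient_smul hr h4 hγc hb hc, Pi.smul_apply, smul_eq_mul,
      hχ _ ⟨γ 0 0, -γ 0 1 * c, by linear_combination hdet⟩]
  meromorphicAtCusps γ := isMeromorphicAtInfty_etaQuotient_slash hN hr γ

end

/-! ### The two cases of the theorem -/

theorem mainTheorem1 (N : ℕ) (hN : 0 < N) (r : ℕ → ℤ)
    (hr : ∑ δ ∈ N.divisors, r δ = 0) :
    ((∑ δ ∈ N.divisors, r δ * (δ : ℤ) ≡ 0 [ZMOD 24]) →
      (∑ δ ∈ N.divisors, r δ * ((N / δ : ℕ) : ℤ) ≡ 0 [ZMOD 24]) →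
      ∃ χ : DirichletCharacter ℂ N, MulChar.IsQuadratic χ ∧
        (∀ d : ℤ, IsCoprime d (N : ℤ) → χ (d : ZMod N) = etaQuotientSign N r d) ∧
        IsModularFunction 0 (CongruenceSubgroup.Gamma0 N) χ (etaQuotient N r)) ∧
    ((∑ δ ∈ N.divisors, r δ * (δ : ℤ) ≡ 0 [ZMOD 8]) →
      (∑ δ ∈ N.divisors, r δ * ((N / δ : ℕ) : ℤ) ≡ 0 [ZMOD 8]) →
      ∃ χ : DirichletCharacter ℂ N, MulChar.IsQuadratic χ ∧
        (∀ d : ℤ, IsCoprime d (N : ℤ) → χ (d : ZMod N) = etaQuotientSign N r d) ∧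
        (¬ 3 ∣ N → IsModularFunction 0
          (CongruenceSubgroup.Gamma0 N ⊓ CongruenceSubgroup.Gamma 6) χ (etaQuotient N r)) ∧
        IsModularFunction 0
          (CongruenceSubgroup.Gamma0 (3 * N) ⊓ CongruenceSubgroup.Gamma 6) χ
          (etaQuotient N r)) := by
  refine ⟨fun h1 h2 => ?_, fun h1 h2 => ?_⟩
  · rw [Int.modEq_zero_iff_dvd] at h1 h2
    obtain ⟨χ, hq, hχ⟩ := exists_dirichletCharacter_eq_etaQuotientSign hr h1 h2
    refine ⟨χ, hq, hχ, isModularFunction_etaQuotient hN hr (Dvd.dvd.trans (by norm_num) h2) hχ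
      fun γ hγ => ⟨h1.mul_left _, ?_⟩⟩
    obtain ⟨c, hc⟩ := (ZMod.intCast_zmod_eq_zero_iff_dvd _ N).1
      (CongruenceSubgroup.Gamma0_mem.1 hγ)
    exact ⟨c, hc, h2.mul_left _⟩
  · rw [Int.modEq_zero_iff_dvd] at h1 h2
    -- Tripling r lifts the congruences from modulo 8 to modulo 24, and leaves the sign unchanged
    -- because every symbol equals its cube.
    obtain ⟨χ, hq, hχ⟩ := exists_dirichletCharacter_eq_etaQuotientSign (N := N)
      (r := fun δ => 3 * r δ) (by rw [← Finset.mul_sum, hr, mul_zero])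
      (by simp only [mul_assoc, ← Finset.mul_sum]; exact mul_dvd_mul_left 3 h1)
      (by simp only [mul_assoc, ← Finset.mul_sum]; exact mul_dvd_mul_left 3 h2)
    simp only [etaQuotientSign_three_mul] at hχ
    have h4 : (4 : ℤ) ∣ ∑ δ ∈ N.divisors, r δ * ((N / δ : ℕ) : ℤ) :=
      Dvd.dvd.trans (by norm_num) h2
    have h6 {x : ℤ} (hx : (x : ZMod 6) = 0) : (3 : ℤ) ∣ x :=
      Dvd.dvd.trans (by norm_num) ((ZMod.intCast_zmod_eq_zero_iff_dvd x 6).1 hx)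
    have h24 {x y : ℤ} (hx : 3 ∣ x) (hy : 8 ∣ y) : 24 ∣ x * y := by
      rw [show (24 : ℤ) = 3 * 8 from rfl]
      exact mul_dvd_mul hx hy
    refine ⟨χ, hq, hχ, fun h3 => isModularFunction_etaQuotient hN hr h4 hχ fun γ hγ => ?_,
      isModularFunction_etaQuotient hN hr h4 hχ fun γ hγ => ?_⟩
    · obtain ⟨hγ0, hγ6⟩ := hγ
      obtain ⟨-, hb, hc6, -⟩ := CongruenceSubgroup.Gamma_mem.1 hγ6
      obtain ⟨c, hc⟩ := (ZMod.intCast_zmod_eq_zero_iff_dvd _ N).1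
        (CongruenceSubgroup.Gamma0_mem.1 hγ0)
      refine ⟨h24 (h6 hb) h1, c, hc, h24 ?_ h2⟩
      -- From 3 ∣ Nc and 3 ∤ N it follows that 3 ∣ c.
      have := h6 hc6
      rw [hc] at this
      exact (Int.prime_three.dvd_or_dvd this).resolve_left (by exact_mod_cast h3)
    · obtain ⟨hγ0, hγ6⟩ := hγ
      obtain ⟨-, hb, -, -⟩ := CongruenceSubgroup.Gamma_mem.1 hγ6
      obtain ⟨c, hc⟩ := (ZMod.intCast_zmod_eq_zero_iff_dvd _ (3 * N)).1
        (CongruenceSubgroup.Gamma0_mem.1 hγ0)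
      refine ⟨h24 (h6 hb) h1, 3 * c, ?_, h24 (dvd_mul_right 3 c) h2⟩
      rw [hc]
      push_cast
      ring
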